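/- Let $k$ be an algebraically closed field of characteristic $0$. Let $n\ge 11$, let $G$ be a finite subgroup of $PGL(3,k)$ with $|G|\ge 6n^2$, and let $f\in k[x,y,z]$ be a non-zero homogeneous polynomial of degree $n$ which is $G$-invariant, i.e. for every $A\in GL(3,k)$ whose class lies in $G$ there is $c\in k^*$ with $f(A^{-1}v)=c\,f(v)$ (as polynomials in $v=(x,y,z)$). Suppose that at least one of the following holds: 1. $G$ leaves the point $(0,0,1)$ invariant; 2. $G$ leaves the line $z=0$ invariant; 3. $G$ permutes cyclically the vertices of a triangle, i.e. there are three non-collinear points of $\mathbb{P}^2(k)$ that $G$ permutes among themselves, inducing on them the cyclic group of order $3$. Then $f$ is singular, i.e. there is a point of $\mathbb{P}^2(k)$ at which $f$ and all three of its first-order partial derivatives vanish. -/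

import Mathlib

open scoped LinearAlgebra.Projectivization MatrixGroups

namespace PlaneCurve

variable {k : Type*} [Field k]

/-- The transform `f_A` of a polynomial `f` in the variables `x, y, z` by `A ∈ GL(3, k)`,
given by `f_A(v) = f(A⁻¹ v)`: the variable with index `i` is replaced by the linear form whose
coefficients are the `i`-th row of `A⁻¹`. -/
noncomputable def transform (A : GL (Fin 3) k) (f : MvPolynomial (Fin 3) k) :
    MvPolynomial (Fin 3) k :=
  MvPolynomial.bind₁
    (fun i => ∑ j, MvPolynomial.C ((A⁻¹ : GL (Fin 3) k).1 i j) * MvPolynomial.X j) f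

/-- `f` is `G`-invariant for a subgroup `G` of `PGL(3, k)`: each matrix `A` whose class lies in `G`
satisfies `f_A = c f` for some `c ∈ k*`. -/
def IsInvariant (G : Subgroup (PGL(3, k))) (f : MvPolynomial (Fin 3) k) : Prop :=
  ∀ A : GL (Fin 3) k, Matrix.ProjGenLinGroup.mk A ∈ G →
    ∃ c : k, c ≠ 0 ∧ transform A f = MvPolynomial.C c * f

/-- The form `f` is singular: the plane curve `f = 0` has a singular point, i.e. there is a nonzero
vector `v` (homogeneous coordinates of the point) at which `f` and its three first order partial
derivatives all vanish. -/
def IsSingular (f : MvPolynomial (Fin 3) k) : Prop :=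
  ∃ v : Fin 3 → k, v ≠ 0 ∧ MvPolynomial.eval v f = 0 ∧
    ∀ i, MvPolynomial.eval v (MvPolynomial.pderiv i f) = 0

variable (k) in
/-- The point `(0, 0, 1)` of the projective plane. -/
noncomputable def pointZ : ℙ k (Fin 3 → k) :=
  Projectivization.mk k ![0, 0, 1] (fun h => one_ne_zero (congrFun h 2))

variable (k) in
/-- The line `z = 0` of the projective plane. -/
def lineZ : Set (ℙ k (Fin 3 → k)) := {p | p.rep 2 = 0}

/-- `G` leaves the point `(0, 0, 1)` invariant. -/
def FixesPointZ (G : Subgroup (PGL(3, k))) : Prop :=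
  ∀ g ∈ G, g • pointZ k = pointZ k

/-- `G` leaves the line `z = 0` invariant (as a set). -/
def FixesLineZ (G : Subgroup (PGL(3, k))) : Prop :=
  ∀ g ∈ G, (fun p => g • p) '' lineZ k = lineZ k

/-- `G` permutes cyclically the vertices of a triangle: there are three non-collinear points
`P 0, P 1, P 2` on which every element of `G` acts as a power of the cyclic permutation
`P 0 → P 1 → P 2 → P 0`, and some element of `G` acts as this 3-cycle. In other words, `G` leaves
the triangle invariant and induces on its vertices the cyclic group of order 3. -/
def PermutesTriangleCyclically (G : Subgroup (PGL(3, k))) : Prop :=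
  ∃ P : Fin 3 → ℙ k (Fin 3 → k), Projectivization.Independent P ∧
    (∀ g ∈ G, ∃ j : Fin 3, ∀ i, g • P i = P (i + j)) ∧
    ∃ g ∈ G, ∀ i, g • P i = P (i + 1)

end PlaneCurve

/-! Argue by contraposition: if `f` is nonsingular of degree `n ≥ 3`, then `|G| < 6n²` in the first
two cases and `|G| ≤ 3n²` in the third.

The core is the diagonal bound `card_le_sq_of_diagonal`. At each vertex `b i` of an eigenbasis the
derivative of `f` is nonzero, so `f` contains a monomial `x_i^(n-1) x_(F i)`. These three monomials
transform by the same character, and in each shape of the map `F` on three indices the resulting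
relations leave at most `n²` diagonal matrices modulo scalars. For a cyclically permuted triangle,
the stabilizer of one vertex fixes all three and has index at most 3.

A fixed point or line allows `G` to be lifted to a matrix group `H` fixing both a vector `v` and a
linear form `l` with `l v = 1`. Let `H` act on the projective line of `W = ker l`. The form `f` is
not identically zero there, so an orbit of zeros has at most `n` points and its stabilizers have
order at least `6n` if `|H| ≥ 6n²`. The kernel consists of homologies and has order at most `n`.
Modulo the kernel the stabilizer thus has order at least 6, and the class equation
(`card_orbit_le_two`) forces the orbit to have at most two points. But the stabilizer is
diagonalizable, of order at most `n²`, so `|H| ≤ 2n²`, a contradiction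
(`card_lt_of_fixed_vector_and_form`). -/

namespace PlaneCurve

/-! ### Forms restricted to lines and their directional derivatives -/

section Forms

open MvPolynomial

variable {k : Type*} [Field k] {σ : Type*}

/-- The restriction of a polynomial to the line `t ↦ x + t u`. -/
noncomputable def restrictLine (x u : σ → k) (f : MvPolynomial σ k) : Polynomial k :=
  aeval (fun i => Polynomial.C (x i) + Polynomial.C (u i) * Polynomial.X) f

lemma eval_restrictLine (x u : σ → k) (f : MvPolynomial σ k) (t : k) :
    (restrictLine x u f).eval t = eval (x + t • u) f := by
  unfold restrictLine
  induction f using MvPolynomial.induction_on with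
  | C a => simp [MvPolynomial.algHom_C]
  | add p q hp hq => simp [hp, hq]
  | mul_X p i hp =>
    simp only [map_mul, aeval_X, Polynomial.eval_mul, hp, eval_X]
    simp [mul_comm t]

lemma natDegree_restrictLine_le (x u : σ → k) {f : MvPolynomial σ k} {n : ℕ}
    (hf : f.IsHomogeneous n) : (restrictLine x u f).natDegree ≤ n := by
  simpa [restrictLine] using aeval_natDegree_le (m := n) (n := 1) f hf.totalDegree_le
    (fun i => Polynomial.C (x i) + Polynomial.C (u i) * Polynomial.X) (fun i => by compute_degree)

variable [Fintype σ]

/-- The directional derivative of a polynomial along the vector `u`. -/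
noncomputable def dirDeriv (u : σ → k) (f : MvPolynomial σ k) : MvPolynomial σ k :=
  ∑ i, C (u i) * pderiv i f

lemma eval_zero_derivative_restrictLine (x u : σ → k) (f : MvPolynomial σ k) :
    (Polynomial.derivative (restrictLine x u f)).eval 0 = eval x (dirDeriv u f) := by
  classical
  unfold restrictLine dirDeriv
  induction f using MvPolynomial.induction_on with
  | C a => simp [MvPolynomial.algHom_C]
  | add p q hp hq => simp [hp, hq, mul_add, Finset.sum_add_distrib]
  | mul_X p i hp =>
    have h := eval_restrictLine x u p 0
    simp only [restrictLine, zero_smul, add_zero] at h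
    simp only [map_mul, aeval_X, Polynomial.derivative_mul, Polynomial.eval_add,
      Polynomial.eval_mul, hp, h]
    simp [Pi.single_apply, mul_add, Finset.sum_add_distrib, Finset.sum_mul,
      Derivation.leibniz, pderiv_X]
    rw [add_comm]
    congr 1
    · ring
    · exact Finset.sum_congr rfl fun _ _ => by ring

lemma eval_smul_of_isHomogeneous {f : MvPolynomial σ k} {n : ℕ} (hf : f.IsHomogeneous n)
    (a : k) (x : σ → k) : eval (a • x) f = a ^ n * eval x f := by
  rw [eval_eq', eval_eq', Finset.mul_sum]
  refine Finset.sum_congr rfl fun d hd => ?_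
  have h : n = ∑ i, d i := by
    rw [← Finsupp.degree_eq_sum]
    by_contra h
    exact mem_support_iff.mp hd (hf.coeff_eq_zero (fun h' => h h'.symm))
  simp only [Pi.smul_apply, smul_eq_mul, mul_pow, Finset.prod_mul_distrib]
  rw [Finset.prod_pow_eq_pow_sum, ← h]
  ring

lemma isHomogeneous_dirDeriv {f : MvPolynomial σ k} {n : ℕ} (hf : f.IsHomogeneous n)
    (u : σ → k) : (dirDeriv u f).IsHomogeneous (n - 1) :=
  IsHomogeneous.sum _ _ _ fun _ _ => hf.pderiv.C_mul _

lemma eval_dirDeriv (x u : σ → k) (f : MvPolynomial σ k) :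
    eval x (dirDeriv u f) = ∑ i, u i * eval x (pderiv i f) := by
  simp [dirDeriv]

/-- The derivative of `f` at `x`, as a linear form. -/
noncomputable def derivAt (x : σ → k) (f : MvPolynomial σ k) : (σ → k) →ₗ[k] k where
  toFun u := eval x (dirDeriv u f)
  map_add' u v := by simp [eval_dirDeriv, add_mul, Finset.sum_add_distrib]
  map_smul' a u := by simp [eval_dirDeriv, Finset.mul_sum, mul_assoc]

lemma derivAt_apply (x u : σ → k) (f : MvPolynomial σ k) :
    derivAt x f u = eval x (dirDeriv u f) := rfl

lemma derivAt_smul {f : MvPolynomial σ k} {n : ℕ} (hf : f.IsHomogeneous n) (a : k)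
    (x u : σ → k) : derivAt (a • x) f u = a ^ (n - 1) * derivAt x f u :=
  eval_smul_of_isHomogeneous (isHomogeneous_dirDeriv hf u) a x

/-- `L` carries the line `x + t u` to `L x + t L u`; compare the coefficients of `t` in the two
restrictions of `f`. An infinite field turns equality of values into equality of polynomials. -/
lemma derivAt_map [Infinite k] {f : MvPolynomial σ k} {c : k} (L : (σ → k) →ₗ[k] (σ → k))
    (h : ∀ x, eval (L x) f = c * eval x f) (x u : σ → k) :
    derivAt (L x) f (L u) = c * derivAt x f u := by
  have : restrictLine (L x) (L u) f = Polynomial.C c * restrictLine x u f := by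
    refine Polynomial.funext fun t => ?_
    rw [Polynomial.eval_mul, Polynomial.eval_C, eval_restrictLine, eval_restrictLine, ← h]
    simp
  rw [derivAt_apply, derivAt_apply, ← eval_zero_derivative_restrictLine, this,
    ← eval_zero_derivative_restrictLine]
  simp

lemma derivAt_eq_zero_of_restrictLine_eq_zero {f : MvPolynomial σ k} {x u : σ → k}
    (h : restrictLine x u f = 0) : derivAt x f u = 0 := by
  rw [derivAt_apply, ← eval_zero_derivative_restrictLine, h]
  simp

/-- If a form of degree `n` is constant on the affine line `x + t u`, it is a multiple of `s ^ n` on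
the affine line `u + s x`. -/
lemma eval_eq_of_eval_add_smul [Infinite k] {f : MvPolynomial σ k} {n : ℕ}
    (hf : f.IsHomogeneous n) {x u : σ → k} {c : k} (h : ∀ t : k, eval (x + t • u) f = c) (s : k) :
    eval (u + s • x) f = c * s ^ n := by
  have : restrictLine u x f = Polynomial.C c * Polynomial.X ^ n := by
    refine Polynomial.eq_of_infinite_eval_eq _ _
      (Set.Infinite.mono ?_ (Set.finite_singleton (0 : k)).infinite_compl)
    intro s hs
    have hs : s ≠ 0 := hs
    have h1 : u + s • x = s • (x + s⁻¹ • u) := by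
      rw [smul_add, smul_smul, mul_inv_cancel₀ hs, one_smul, add_comm]
    change Polynomial.eval s _ = Polynomial.eval s _
    simp only [eval_restrictLine, Polynomial.eval_mul, Polynomial.eval_C,
      Polynomial.eval_pow, Polynomial.eval_X]
    rw [h1, eval_smul_of_isHomogeneous hf, h, mul_comm]
  rw [← eval_restrictLine, this]
  simp

/-- A binary form of positive degree over an algebraically closed field has a nontrivial zero. -/
lemma exists_eval_eq_zero_of_plane [IsAlgClosed k] {f : MvPolynomial σ k} {n : ℕ}
    (hf : f.IsHomogeneous n) (hn : n ≠ 0) {x u : σ → k} :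
    ∃ s t : k, (s ≠ 0 ∨ t ≠ 0) ∧ eval (s • x + t • u) f = 0 := by
  have : Infinite k := IsAlgClosed.instInfinite
  -- A nonzero constant restriction has no root, but then the zero is the point at infinity `u` of
  -- the line.
  by_cases hd : (restrictLine x u f).degree = 0
  · refine ⟨0, 1, Or.inr one_ne_zero, ?_⟩
    have h := eval_eq_of_eval_add_smul hf (x := x) (u := u) (c := (restrictLine x u f).coeff 0)
      (fun t => by
        rw [← eval_restrictLine]
        conv_lhs => rw [Polynomial.eq_C_of_degree_eq_zero hd]
        simp) 0
    simpa [hn] using h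
  · obtain ⟨t, ht⟩ := IsAlgClosed.exists_root _ hd
    refine ⟨1, t, Or.inl one_ne_zero, ?_⟩
    rw [one_smul, ← eval_restrictLine]
    exact ht

end Forms

/-! ### Nonvanishing derivatives of a nonsingular form -/

section Singular

open MvPolynomial

variable {k : Type*} [Field k]

/-- The derivative of a nonsingular form does not vanish at any point of the plane. -/
lemma derivAt_ne_zero [CharZero k] {f : MvPolynomial (Fin 3) k} {n : ℕ} (hn : n ≠ 0)
    (hdeg : f.IsHomogeneous n) (hf : ¬ IsSingular f) {x : Fin 3 → k} (hx : x ≠ 0) :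
    derivAt x f ≠ 0 := by
  classical
  intro h0
  have hp : ∀ i, eval x (pderiv i f) = 0 := fun i => by
    simpa [derivAt_apply, eval_dirDeriv, Pi.single_apply] using
      LinearMap.congr_fun h0 (Pi.single i 1)
  refine hf ⟨x, hx, ?_, hp⟩
  -- Euler's identity gives `n f(x) = 0`, and `n` is invertible in characteristic 0.
  have h := congrArg (eval x) hdeg.sum_X_mul_pderiv
  simpa [hp, hn] using h

/-- Taken at a basis vector `x = b i`, this says that some monomial `x_i^(n-1) x_j` occurs in `f`
written in the coordinates of `b`. -/
lemma exists_derivAt_basis_ne_zero [CharZero k] {f : MvPolynomial (Fin 3) k} {n : ℕ} (hn : n ≠ 0)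
    (hdeg : f.IsHomogeneous n) (hf : ¬ IsSingular f) {x : Fin 3 → k} (hx : x ≠ 0)
    {ι : Type*} {b : ι → Fin 3 → k} (hb : Submodule.span k (Set.range b) = ⊤) :
    ∃ j, derivAt x f (b j) ≠ 0 := by
  by_contra! h
  refine derivAt_ne_zero hn hdeg hf hx (LinearMap.ext_on_range hb fun i => ?_)
  simpa using h i

end Singular

/-! ### Counting diagonal groups through relations between characters -/

section Characters

variable {H : Type*} [Group H] {k : Type*} [Field k]

lemma card_le_of_pow_eq_one (s : H →* kˣ) {K : ℕ} (hK : K ≠ 0) (h : ∀ g, s g ^ K = 1)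
    (hs : ∀ g, s g = 1 → g = 1) : Nat.card H ≤ K := by
  have : NeZero K := ⟨hK⟩
  let φ : H → rootsOfUnity K k := fun g => ⟨s g, h g⟩
  have hφ : Function.Injective φ := fun a b hab => by
    have : s a = s b := congrArg Subtype.val hab
    rw [← mul_inv_eq_one]
    exact hs _ (by rw [map_mul, map_inv, this, mul_inv_cancel])
  calc Nat.card H ≤ Nat.card (rootsOfUnity K k) := Nat.card_le_card_of_injective φ hφ
    _ ≤ K := card_rootsOfUnity k K

/-- The image of `s` lies in the `K`-th roots of unity, and `t` embeds the kernel of `s` in the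
`L`-th ones. Hence the exponent of `t` matters only on that kernel. -/
lemma card_le_mul_of_pow_eq_one (s t : H →* kˣ) {K L : ℕ} (hK : K ≠ 0) (hL : L ≠ 0)
    (h : ∀ g, s g ^ K = 1) (h' : ∀ g, s g = 1 → t g ^ L = 1)
    (hst : ∀ g, s g = 1 → t g = 1 → g = 1) : Nat.card H ≤ K * L := by
  have : NeZero K := ⟨hK⟩
  rw [← s.ker.card_mul_index, Subgroup.index_ker, mul_comm]
  refine Nat.mul_le_mul ?_ ?_
  · have hle : s.range ≤ rootsOfUnity K k := by
      rintro _ ⟨g, rfl⟩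
      exact h g
    calc Nat.card s.range ≤ Nat.card (rootsOfUnity K k) :=
          Nat.card_le_card_of_injective _ (Subgroup.inclusion_injective hle)
      _ ≤ K := card_rootsOfUnity k K
  · refine card_le_of_pow_eq_one (t.comp s.ker.subtype) hL (fun g => h' g g.2) fun g hg => ?_
    exact Subtype.ext (hst g g.2 hg)

/-- The case of `card_le_sq_of_relations` in which the third relation is `z ^ n`. -/
lemma card_le_sq_of_fixed_relation (X Y : H →* kˣ) {m : ℕ} (hm : 2 ≤ m)
    (hX : (∀ g, X g ^ (m + 1) = 1) ∨ (∀ g, X g ^ m = 1) ∨ ∀ g, X g ^ m * Y g = 1)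
    (hY : (∀ g, Y g ^ (m + 1) = 1) ∨ (∀ g, Y g ^ m = 1) ∨ ∀ g, Y g ^ m * X g = 1)
    (hXY : ∀ g, X g = 1 → Y g = 1 → g = 1) : Nat.card H ≤ (m + 1) ^ 2 := by
  have key : ∀ X Y : H →* kˣ, ((∀ g, X g ^ (m + 1) = 1) ∨ (∀ g, X g ^ m = 1)) →
      ((∀ g, Y g ^ (m + 1) = 1) ∨ (∀ g, Y g ^ m = 1) ∨ ∀ g, Y g ^ m * X g = 1) →
      (∀ g, X g = 1 → Y g = 1 → g = 1) → Nat.card H ≤ (m + 1) ^ 2 := by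
    intro X Y hX hY hXY
    obtain ⟨K, hK0, hK, hX⟩ : ∃ K, K ≠ 0 ∧ K ≤ m + 1 ∧ ∀ g, X g ^ K = 1 := by
      rcases hX with h | h
      · exact ⟨_, by omega, le_rfl, h⟩
      · exact ⟨_, by omega, by omega, h⟩
    obtain ⟨L, hL0, hL, hY⟩ : ∃ L, L ≠ 0 ∧ L ≤ m + 1 ∧ ∀ g, X g = 1 → Y g ^ L = 1 := by
      rcases hY with h | h | h
      · exact ⟨_, by omega, le_rfl, fun g _ => h g⟩
      · exact ⟨m, by omega, by omega, fun g _ => h g⟩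
      · exact ⟨m, by omega, by omega, fun g hg => by simpa [hg] using h g⟩
    calc Nat.card H ≤ K * L := card_le_mul_of_pow_eq_one X Y hK0 hL0 hX hY hXY
      _ ≤ (m + 1) * (m + 1) := Nat.mul_le_mul hK hL
      _ = (m + 1) ^ 2 := by ring
  rcases hX with h1 | h1 | h1
  · exact key X Y (Or.inl h1) hY hXY
  · exact key X Y (Or.inr h1) hY hXY
  rcases hY with h2 | h2 | h2
  · exact key Y X (Or.inl h2) (Or.inr (Or.inr h1)) fun g a b => hXY g b a
  · exact key Y X (Or.inr h2) (Or.inr (Or.inr h1)) fun g a b => hXY g b a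
  have hY' : ∀ g, Y g = (X g ^ m)⁻¹ := fun g => eq_inv_of_mul_eq_one_right (h1 g)
  -- Here `Y = X^(-m)` and `X^(m² - 1) = 1`, so `X` is faithful; the substitution writes `m² - 1` as
  -- `(l + 1)(l + 3)`.
  obtain ⟨l, rfl⟩ : ∃ l, m = l + 2 := ⟨m - 2, by omega⟩
  calc Nat.card H ≤ (l + 1) * (l + 3) := by
        refine card_le_of_pow_eq_one X (by positivity) (fun g => ?_) fun g hg => ?_
        · have h := h2 g
          rw [hY', inv_pow, ← pow_mul, inv_mul_eq_one] at h
          have e : X g * X g ^ ((l + 1) * (l + 3)) = X g * 1 := by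
            rw [mul_one, ← pow_succ']
            convert h using 2
            ring
          exact mul_left_cancel e
        · exact hXY g hg (by rw [hY', hg]; simp)
    _ ≤ (l + 2 + 1) ^ 2 := by nlinarith

/-- A group of diagonal matrices modulo scalars, with diagonal characters `a i`, has
order at most `(m + 1) ^ 2` if monomials of the form `x i ^ m * x (F i)`, one for each `i`, are
semi-invariant with the same character. -/
lemma card_le_sq_of_relations (a : Fin 3 → H →* kˣ) (F : Fin 3 → Fin 3) {m : ℕ} (hm : 2 ≤ m)
    (hrel : ∀ i j g, a i g ^ m * a (F i) g = a j g ^ m * a (F j) g)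
    (hfaith : ∀ g, (∀ i j, a i g = a j g) → g = 1) : Nat.card H ≤ (m + 1) ^ 2 := by
  have third : ∀ i j l : Fin 3, i ≠ j → i ≠ l → j ≠ l → ∀ p, p = i ∨ p = j ∨ p = l := by decide
  have faith : ∀ i j l : Fin 3, i ≠ j → i ≠ l → j ≠ l →
      ∀ g, a i g = a l g → a j g = a l g → g = 1 := by
    intro i j l hij hil hjl g h1 h2
    have : ∀ p, a p g = a l g := fun p => by
      rcases third i j l hij hil hjl p with rfl | rfl | rfl <;> simp [h1, h2]
    exact hfaith g fun p q => by rw [this p, this q]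
  -- a relation with a fixed index
  have fixed : ∀ i j l : Fin 3, i ≠ j → i ≠ l → j ≠ l → F l = l → Nat.card H ≤ (m + 1) ^ 2 := by
    intro i j l hij hil hjl hl
    have hrel' : ∀ p q g, F p = q → (a p / a l) g ^ m * (a q / a l) g = 1 := by
      intro p q g hpq
      have h := hrel p l g
      rw [hpq, hl] at h
      simp only [MonoidHom.div_apply, div_pow, div_mul_div_comm, h, div_self']
    refine card_le_sq_of_fixed_relation (a i / a l) (a j / a l) hm ?_ ?_ ?_
    · rcases third i j l hij hil hjl (F i) with h | h | h
      · exact Or.inl fun g => by rw [pow_succ]; exact hrel' i i g h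
      · exact Or.inr (Or.inr fun g => hrel' i j g h)
      · exact Or.inr (Or.inl fun g => by simpa using hrel' i l g h)
    · rcases third i j l hij hil hjl (F j) with h | h | h
      · exact Or.inr (Or.inr fun g => hrel' j i g h)
      · exact Or.inl fun g => by rw [pow_succ]; exact hrel' j j g h
      · exact Or.inr (Or.inl fun g => by simpa using hrel' j l g h)
    · intro g h1 h2
      exact faith i j l hij hil hjl g (div_eq_one.mp h1) (div_eq_one.mp h2)
  -- a two-cycle and a further index
  have swap : ∀ i j l : Fin 3, i ≠ j → i ≠ l → j ≠ l → F i = j → F j = i → F l = i →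
      Nat.card H ≤ (m + 1) ^ 2 := by
    intro i j l hij hil hjl hi hj hl
    obtain ⟨p, rfl⟩ : ∃ p, m = p + 1 := ⟨m - 1, by omega⟩
    -- The two-cycle gives `(a i / a j)^(m-1) = 1`; where `a i = a j`, the tail gives `(a l / a i)^m
    -- = 1`.
    calc Nat.card H ≤ p * (p + 1) := by
          refine card_le_mul_of_pow_eq_one (a i / a j) (a l / a i) (by omega) (by omega) ?_ ?_ ?_
          · intro g
            have h := hrel i j g
            rw [hi, hj, pow_succ, pow_succ, mul_assoc, mul_assoc, mul_comm (a j g) (a i g)] at h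
            rw [MonoidHom.div_apply, div_pow, mul_right_cancel h, div_self']
          · intro g hg
            have h := hrel l j g
            rw [hl, hj] at h
            rw [MonoidHom.div_apply, div_eq_one] at hg
            rw [MonoidHom.div_apply, div_pow, mul_right_cancel h, hg, div_self']
          · intro g h1 h2
            rw [MonoidHom.div_apply, div_eq_one] at h1 h2
            exact faith i j l hij hil hjl g h2.symm (h1.symm.trans h2.symm)
      _ ≤ (p + 1 + 1) ^ 2 := by nlinarith
  -- a three-cycle
  have cycle : ∀ i j l : Fin 3, i ≠ j → i ≠ l → j ≠ l → F i = j → F j = l → F l = i →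
      Nat.card H ≤ (m + 1) ^ 2 := by
    intro i j l hij hil hjl hi hj hl
    obtain ⟨p, rfl⟩ : ∃ p, m = p + 1 := ⟨m - 1, by omega⟩
    have hX : ∀ g, (a i / a l) g = (a j / a l) g ^ (p + 1) := by
      intro g
      have h := hrel j l g
      rw [hj, hl] at h
      rw [MonoidHom.div_apply, MonoidHom.div_apply, div_pow, div_eq_div_iff_mul_eq_mul, mul_comm]
      exact h.symm
    have hXY : ∀ g, (a i / a l) g ^ (p + 1) * (a j / a l) g = (a i / a l) g := by
      intro g
      have h := hrel i l g
      rw [hi, hl] at h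
      simp only [MonoidHom.div_apply, div_pow, div_mul_div_comm, h, mul_div_mul_left_eq_div]
    -- With `X = a i / a l` and `Y = a j / a l` one has `X = Y^m` and `X^m Y = X`. Thus `Y` is
    -- faithful and `Y^(m² - m + 1) = 1`.
    calc Nat.card H ≤ (p + 1) * p + 1 := by
          refine card_le_of_pow_eq_one (a j / a l) (by omega) (fun g => ?_) fun g hg => ?_
          · have h := hXY g
            rw [hX] at h
            have e : (a j / a l) g ^ (p + 1) * (a j / a l) g ^ ((p + 1) * p + 1) =
                (a j / a l) g ^ (p + 1) * 1 := by
              rw [mul_one, ← pow_add]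
              rw [← pow_mul, ← pow_succ] at h
              convert h using 2
              ring
            exact mul_left_cancel e
          · refine faith i j l hij hil hjl g (div_eq_one.mp ?_) (div_eq_one.mp hg)
            have h := hX g
            rw [hg, one_pow] at h
            exact h
      _ ≤ (p + 1 + 1) ^ 2 := by nlinarith
  by_contra hcard
  have hne : ∀ l, F l ≠ l := by
    intro l hl
    have pick : ∀ l : Fin 3, ∃ i j : Fin 3, i ≠ j ∧ i ≠ l ∧ j ≠ l := by decide
    obtain ⟨i, j, hij, hil, hjl⟩ := pick l
    exact hcard (fixed i j l hij hil hjl hl)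
  have two : ∀ p q : Fin 3, q ≠ p → q = p + 1 ∨ q = p + 2 := by decide
  have d01 : (0 : Fin 3) ≠ 1 := by decide
  have d02 : (0 : Fin 3) ≠ 2 := by decide
  have d12 : (1 : Fin 3) ≠ 2 := by decide
  have h0 : F 0 = 1 ∨ F 0 = 2 := two 0 _ (hne 0)
  have h1 : F 1 = 2 ∨ F 1 = 0 := two 1 _ (hne 1)
  have h2 : F 2 = 0 ∨ F 2 = 1 := two 2 _ (hne 2)
  apply hcard
  rcases h0 with h0 | h0 <;> rcases h1 with h1 | h1 <;> rcases h2 with h2 | h2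
  · exact cycle 0 1 2 d01 d02 d12 h0 h1 h2
  · exact swap 1 2 0 d12 d01.symm d02.symm h1 h2 h0
  · exact swap 0 1 2 d01 d02 d12 h0 h1 h2
  · exact swap 1 0 2 d01.symm d12 d02 h1 h0 h2
  · exact swap 2 0 1 d02.symm d12.symm d01 h2 h0 h1
  · exact swap 2 1 0 d12.symm d02.symm d01.symm h2 h1 h0
  · exact swap 0 2 1 d02 d01 d12.symm h0 h2 h1
  · exact cycle 0 2 1 d02 d01 d12.symm h0 h2 h1

end Characters

/-- A group acting linearly on `k³`, faithfully modulo scalars and diagonally with respect to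
some basis, has order at most `n ^ 2` if a nonsingular form of degree `n` is semi-invariant. -/
theorem card_le_sq_of_diagonal {k : Type*} [Field k] [CharZero k] {H : Type*} [Group H]
    [DistribMulAction H (Fin 3 → k)] [SMulCommClass H k (Fin 3 → k)]
    {f : MvPolynomial (Fin 3) k} {n : ℕ} (hn : 3 ≤ n) (hdeg : f.IsHomogeneous n)
    (hf : ¬ IsSingular f)
    (hinv : ∀ g : H, ∃ c : k, ∀ x : Fin 3 → k, MvPolynomial.eval (g • x) f =
      c * MvPolynomial.eval x f)
    {b : Fin 3 → Fin 3 → k} (hb : LinearIndependent k b) (a : Fin 3 → H →* kˣ)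
    (hab : ∀ i g, g • b i = a i g • b i) (hfaith : ∀ g, (∀ i j, a i g = a j g) → g = 1) :
    Nat.card H ≤ n ^ 2 := by
  have hspan : Submodule.span k (Set.range b) = ⊤ :=
    hb.span_eq_top_of_card_eq_finrank (by simp)
  choose F hF using fun i => exists_derivAt_basis_ne_zero (by omega) hdeg hf (hb.ne_zero i) hspan
  obtain ⟨m, rfl⟩ : ∃ m, n = m + 1 := ⟨n - 1, by omega⟩
  choose c hc using hinv
  -- The derivative at `b i` along `b (F i)` is nonzero and is scaled by both sides under `g`.
  have key : ∀ i g, ((a i g ^ m * a (F i) g : kˣ) : k) = c g := by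
    intro i g
    have h := derivAt_map (DistribSMul.toLinearMap k (Fin 3 → k) g) (hc g) (b i) (b (F i))
    simp only [DistribSMul.toLinearMap_apply, hab, Units.smul_def] at h
    rw [derivAt_smul hdeg, map_smul, Nat.add_sub_cancel, smul_eq_mul, ← mul_assoc] at h
    push_cast
    exact mul_right_cancel₀ (hF i) h
  exact card_le_sq_of_relations a F (by omega)
    (fun i j g => Units.ext ((key i g).trans (key j g).symm)) hfaith

/-! ### The class equation for actions with two fixed points per element -/

section OrbitCounting

/-- The arithmetic of the class equation of a group of order `N` all of whose nontrivial elements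
have exactly two fixed points: here `o i` are the sizes of the orbits of points with nontrivial
stabilizers and `r i` the orders of these stabilizers. -/
lemma orbit_le_two_of_class_equation {ι : Type*} [Fintype ι] [DecidableEq ι] {N : ℕ} (hN : 0 < N)
    (o r : ι → ℕ) (hor : ∀ i, o i * r i = N) (hr : ∀ i, 2 ≤ r i)
    (hsum : Fintype.card ι * N + 2 = ∑ i, o i + 2 * N) (i₀ : ι) (hi₀ : 6 ≤ r i₀) : o i₀ ≤ 2 := by
  have h6 : 6 * o i₀ ≤ N := by rw [← hor i₀, mul_comm]; exact Nat.mul_le_mul le_rfl hi₀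
  have h2 : ∀ i, 2 * o i ≤ N := fun i => by
    rw [← hor i, mul_comm]; exact Nat.mul_le_mul le_rfl (hr i)
  have hpos : ∀ i, 0 < o i := fun i => Nat.pos_of_mul_pos_right (by rw [hor]; exact hN)
  set s := Finset.univ.erase i₀ with hs
  have hcard : Fintype.card ι = s.card + 1 := by
    rw [hs, Finset.card_erase_of_mem (Finset.mem_univ _), Finset.card_univ]
    have := Fintype.card_pos_iff.mpr ⟨i₀⟩
    omega
  have hsplit : ∑ i, o i = o i₀ + ∑ i ∈ s, o i :=
    (Finset.add_sum_erase _ _ (Finset.mem_univ i₀)).symm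
  have hle : 2 * ∑ i ∈ s, o i ≤ s.card * N := by
    rw [Finset.mul_sum, ← smul_eq_mul, ← Finset.sum_const]
    exact Finset.sum_le_sum fun i _ => h2 i
  -- Divided by `N`, the class equation reads `∑ (1 - 1/r i) = 2 - 2/N`; the term at `i₀` is at
  -- least 5/6 and each other at least 1/2.
  have hsmall : s.card < 3 := by
    by_contra! h
    rw [hcard, hsplit] at hsum
    nlinarith [Nat.mul_le_mul_right N h]
  rw [hcard, hsplit] at hsum
  by_cases hc0 : s.card = 0
  · rw [hc0] at hsum hle; omega
  by_cases hc1 : s.card = 1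
  · rw [hc1] at hsum hle; omega
  have hc2 : s.card = 2 := by omega
  obtain ⟨i, j, hij, hsij⟩ := Finset.card_eq_two.mp hc2
  rw [hc2, hsij, Finset.sum_pair hij] at hsum
  -- The three orbit sizes add up to `N + 2`, whereas `1/6 + 1/3 + 1/2 = 1`. So both other
  -- stabilizers have order 2, their orbits have `N/2` points each, and 2 points remain (the
  -- dihedral case).
  have key : ∀ i j, (2 + 1) * N + 2 = o i₀ + (o i + o j) + 2 * N → r i = 2 := by
    intro i j h
    by_contra h3
    have h3 : 3 ≤ r i := by have := hr i; omega
    have : 3 * o i ≤ N := by rw [← hor i, mul_comm]; exact Nat.mul_le_mul le_rfl h3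
    have := h2 j
    omega
  have h1 := hor i
  have h2 := hor j
  rw [key i j hsum] at h1
  rw [key j i (by omega)] at h2
  omega

variable {H P : Type*} [Group H] [MulAction H P]

open MulAction

lemma card_orbit_mul_card_stabilizer (p : P) :
    Nat.card (orbit H p) * Nat.card (stabilizer H p) = Nat.card H := by
  rw [← Nat.card_prod, Nat.card_congr (orbitProdStabilizerEquivGroup H p)]

variable [Finite H]

/-- In a finite group acting in such a way that every nontrivial element has exactly two fixed
points, an orbit whose stabilizers have order at least `6` has at most two elements. -/
lemma card_orbit_le_two (hfix : ∀ g : H, g ≠ 1 → (fixedBy P g).ncard = 2) (p : P)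
    (hp : 6 ≤ Nat.card (stabilizer H p)) : Nat.card (orbit H p) ≤ 2 := by
  classical
  have := Fintype.ofFinite H
  -- Burnside's lemma needs a finite set, so it is applied to the points with nontrivial stabilizer.
  -- On them the identity fixes `|X|` points and every other element 2.
  let X : SubMulAction H P :=
    { carrier := {x | ∃ g : H, g ≠ 1 ∧ g • x = x}
      smul_mem' := by
        rintro h x ⟨g, hg, hgx⟩
        exact ⟨h * g * h⁻¹, by simpa [mul_inv_eq_one] using hg, by simp [mul_smul, hgx]⟩ }
  have hXmem : ∀ x : P, x ∈ X ↔ ∃ g : H, g ≠ 1 ∧ g • x = x := fun x => Iff.rfl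
  have hstab : ∀ x : X, stabilizer H x = stabilizer H (x : P) := fun x =>
    SubMulAction.stabilizer_of_subMul x
  have hfinX : Finite X := by
    have : (⋃ g ∈ {g : H | g ≠ 1}, fixedBy P g).Finite :=
      (Set.toFinite _).biUnion fun g hg => Set.finite_of_ncard_ne_zero (by rw [hfix g hg]; simp)
    refine (this.subset ?_).to_subtype
    rintro x ⟨g, hg, hgx⟩
    exact Set.mem_biUnion hg hgx
  have := Fintype.ofFinite X
  have hcardfix : ∀ g : H, g ≠ 1 → Fintype.card (fixedBy X g) = 2 := by
    intro g hg
    rw [← hfix g hg, ← Nat.card_eq_fintype_card, ← Nat.card_coe_set_eq]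
    exact Nat.card_congr
      { toFun := fun x => ⟨x.1.1, congrArg Subtype.val x.2⟩
        invFun := fun x => ⟨⟨x.1, g, hg, x.2⟩, Subtype.ext x.2⟩
        left_inv := fun _ => rfl
        right_inv := fun _ => rfl }
  have hburn := sum_card_fixedBy_eq_card_orbits_mul_card_group H X
  rw [← Finset.add_sum_erase _ _ (Finset.mem_univ (1 : H)),
    Finset.sum_congr rfl (fun g hg => hcardfix g (Finset.ne_of_mem_erase hg)), Finset.sum_const,
    Finset.card_erase_of_mem (Finset.mem_univ _), Finset.card_univ, smul_eq_mul] at hburn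
  have hone : Fintype.card (fixedBy X (1 : H)) = Fintype.card X := by
    rw [← Nat.card_eq_fintype_card, ← Nat.card_eq_fintype_card, fixedBy_one_eq_univ]
    exact Nat.card_congr (Equiv.Set.univ _)
  have hX : Fintype.card X =
      ∑ ω : orbitRel.Quotient H X, Nat.card (orbit H (Quotient.out ω)) := by
    rw [← Nat.card_eq_fintype_card, Nat.card_congr (selfEquivSigmaOrbits H X), Nat.card_sigma]
  have hpX : p ∈ X := by
    have : Nontrivial (stabilizer H p) := Finite.one_lt_card_iff_nontrivial.mp (by omega)
    obtain ⟨g, hg⟩ := exists_ne (1 : stabilizer H p)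
    exact ⟨g, fun h => hg (Subtype.ext h), g.2⟩
  have hpos : 0 < Nat.card H := Nat.card_pos
  have horbP : Nat.card (orbit H p) = Nat.card (orbit H (⟨p, hpX⟩ : X)) := by
    rw [← SubMulAction.val_image_orbit (⟨p, hpX⟩ : X)]
    exact Nat.card_image_of_injective Subtype.val_injective _
  set ω₀ : orbitRel.Quotient H X := Quotient.mk _ ⟨p, hpX⟩
  have horb₀ : orbit H (Quotient.out ω₀) = orbit H (⟨p, hpX⟩ : X) :=
    orbit_eq_iff.mpr (Quotient.exact (Quotient.out_eq ω₀))
  have hr₀ : Nat.card (stabilizer H (Quotient.out ω₀)) = Nat.card (stabilizer H p) := by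
    have h1 := card_orbit_mul_card_stabilizer (H := H) (Quotient.out ω₀)
    have h2 := card_orbit_mul_card_stabilizer (H := H) (⟨p, hpX⟩ : X)
    rw [hstab] at h2
    rw [horb₀, ← h2] at h1
    refine Nat.eq_of_mul_eq_mul_left (Nat.pos_of_mul_pos_right (b := Nat.card (stabilizer H p)) ?_) h1
    rw [h2]
    exact hpos
  rw [horbP, ← horb₀]
  refine orbit_le_two_of_class_equation (N := Nat.card H) hpos
    (fun ω : orbitRel.Quotient H X => Nat.card (orbit H (Quotient.out ω)))
    (fun ω => Nat.card (stabilizer H (Quotient.out ω))) (fun ω => card_orbit_mul_card_stabilizer _) (fun ω => ?_) ?_ ω₀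
    (by simpa only [hr₀] using hp)
  · obtain ⟨g, hg, hgx⟩ := (Quotient.out ω).2
    rw [hstab]
    have : Nontrivial (stabilizer H ((Quotient.out ω : X) : P)) :=
      ⟨⟨g, hgx⟩, 1, fun h => hg (congrArg Subtype.val h)⟩
    exact Finite.one_lt_card
  · rw [← hX]
    rw [hone] at hburn
    rw [Nat.card_eq_fintype_card] at hpos ⊢
    rw [← hburn]
    omega

/-- The version of `card_orbit_le_two` for not necessarily faithful actions. -/
lemma card_orbit_le_two_of_ker (hfix : ∀ g : H, g ∉ (toPermHom H P).ker → (fixedBy P g).ncard = 2)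
    (p : P) (hp : 6 * Nat.card (toPermHom H P).ker ≤ Nat.card (stabilizer H p)) :
    Nat.card (orbit H p) ≤ 2 := by
  have horb : orbit H p = orbit (toPermHom H P).range p := by
    ext x
    constructor
    · rintro ⟨g, rfl⟩
      exact ⟨⟨_, g, rfl⟩, rfl⟩
    · rintro ⟨⟨_, g, rfl⟩, rfl⟩
      exact ⟨g, rfl⟩
  have : Finite (toPermHom H P).range := (Set.finite_range (toPermHom H P)).to_subtype
  rw [horb]
  refine card_orbit_le_two ?_ p ?_
  · rintro ⟨_, g, rfl⟩ hg
    exact hfix g fun h => hg (Subtype.ext h)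
  · have h1 := card_orbit_mul_card_stabilizer (H := H) p
    have h2 := card_orbit_mul_card_stabilizer (H := (toPermHom H P).range) p
    have h3 := (toPermHom H P).ker.card_mul_index
    rw [Subgroup.index_ker] at h3
    rw [horb] at h1
    have hpos : 0 < Nat.card (orbit (toPermHom H P).range p) :=
      Nat.pos_of_mul_pos_right (by rw [h2]; exact Nat.card_pos)
    have hpos' : 0 < Nat.card (toPermHom H P).ker := Nat.card_pos
    have h4 : Nat.card (stabilizer H p) =
        Nat.card (toPermHom H P).ker * Nat.card (stabilizer (toPermHom H P).range p) := by
      refine Nat.eq_of_mul_eq_mul_left hpos ?_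
      rw [h1, ← h3, ← h2]
      ring
    rw [h4, mul_comm] at hp
    exact Nat.le_of_mul_le_mul_left hp hpos'

end OrbitCounting

/-! ### Eigenvectors of finite groups and the projective line -/

section Representations

variable {k : Type*} [Field k] {H : Type*} [Group H] {W : Type*} [AddCommGroup W] [Module k W]
  [DistribMulAction H W] [SMulCommClass H k W]

/-- The character by which a group acts on a common eigenvector. -/
lemma exists_character {e : W} (he : e ≠ 0) (h : ∀ g : H, ∃ c : k, g • e = c • e) :
    ∃ a : H →* kˣ, ∀ g, g • e = a g • e := by
  choose c hc using h
  have huniq : ∀ {x y : k}, x • e = y • e → x = y := fun h => smul_left_injective k he h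
  have hne : ∀ g, c g ≠ 0 := fun g h0 => by
    have h := hc g
    rw [h0, zero_smul, smul_eq_zero_iff_eq] at h
    exact he h
  refine ⟨⟨⟨fun g => Units.mk0 (c g) (hne g), ?_⟩, ?_⟩, hc⟩
  · refine Units.ext (huniq ?_)
    simp [← hc]
  · refine fun g g' => Units.ext (huniq ?_)
    simp only [Units.val_mk0, Units.val_mul]
    rw [← hc, mul_smul, mul_smul, hc g', smul_comm g, hc g, smul_comm]

/-- An eigenvector of a finite group admits a dual eigenform. -/
lemma exists_semiinvariant_form [CharZero k] [Finite H] {e : W} (he : e ≠ 0) (a : H →* kˣ)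
    (ha : ∀ g, g • e = a g • e) :
    ∃ l : W →ₗ[k] k, l e = 1 ∧ ∀ (g : H) (x : W), l (g • x) = a g * l x := by
  have := Fintype.ofFinite H
  obtain ⟨l₀, hl₀⟩ := Module.Projective.exists_dual_ne_zero k he
  have hcard : (Fintype.card H : k) ≠ 0 := Nat.cast_ne_zero.mpr Fintype.card_ne_zero
  -- Average a form not vanishing at `e`, twisted by the inverse character; the prefactor normalizes
  -- the value at `e` to 1.
  let l : W →ₗ[k] k := ((Fintype.card H : k) * l₀ e)⁻¹ •
    ∑ h : H, (((a h)⁻¹ : kˣ) : k) • l₀ ∘ₗ DistribSMul.toLinearMap k W h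
  have hl : ∀ x, l x = ((Fintype.card H : k) * l₀ e)⁻¹ *
      ∑ h : H, (((a h)⁻¹ : kˣ) : k) * l₀ (h • x) := fun x => by simp [l]
  refine ⟨l, ?_, fun g x => ?_⟩
  · rw [hl]
    have : ∀ h : H, (((a h)⁻¹ : kˣ) : k) * l₀ (h • e) = l₀ e := fun h => by
      rw [ha, Units.smul_def, map_smul, smul_eq_mul, ← mul_assoc, Units.inv_mul, one_mul]
    rw [Finset.sum_congr rfl fun h _ => this h]
    simp only [Finset.sum_const, Finset.card_univ, nsmul_eq_mul]
    exact inv_mul_cancel₀ (mul_ne_zero hcard hl₀)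
  · rw [hl, hl, ← Equiv.sum_comp (Equiv.mulRight g⁻¹), mul_left_comm]
    congr 1
    rw [Finset.mul_sum]
    refine Finset.sum_congr rfl fun h _ => ?_
    simp [mul_smul]
    ring

/-- Maschke's theorem in dimension 2: the kernel of the dual eigenform is a stable line
complementary to `e`. -/
lemma exists_complementary_eigenvector [CharZero k] [Finite H] (hW : Module.finrank k W = 2)
    {e : W} (he : e ≠ 0) (a : H →* kˣ) (ha : ∀ g, g • e = a g • e) :
    ∃ (e' : W) (a' : H →* kˣ), LinearIndependent k ![e, e'] ∧ ∀ g, g • e' = a' g • e' := by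
  have : FiniteDimensional k W := Module.finite_of_finrank_eq_succ hW
  obtain ⟨l, hle, hl⟩ := exists_semiinvariant_form he a ha
  have hsurj : Function.Surjective l := fun c => ⟨c • e, by simp [hle]⟩
  have hker : Module.finrank k l.ker = 1 := by
    have := l.finrank_range_add_finrank_ker
    rw [LinearMap.range_eq_top.mpr hsurj, finrank_top, Module.finrank_self, hW] at this
    omega
  obtain ⟨⟨e', hle'⟩, he', hspan⟩ := finrank_eq_one_iff'.mp hker
  have hle' : l e' = 0 := hle'
  have he' : e' ≠ 0 := fun h => he' (Subtype.ext h)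
  obtain ⟨a', ha'⟩ := exists_character (H := H) (k := k) he' fun g => by
    obtain ⟨c, hc⟩ := hspan ⟨g • e', by simp [hl, hle']⟩
    exact ⟨c, (congrArg Subtype.val hc).symm⟩
  refine ⟨e', a', ?_, ha'⟩
  rw [LinearIndependent.pair_iff]
  intro s t hst
  have hs : s = 0 := by simpa [hle, hle'] using congrArg l hst
  subst hs
  exact ⟨rfl, by simpa [he'] using hst⟩

lemma smul_mk_eq_iff (g : H) {e : W} (he : e ≠ 0) :
    g • Projectivization.mk k e he = Projectivization.mk k e he ↔ ∃ c : k, g • e = c • e := by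
  rw [Projectivization.smul_mk, Projectivization.mk_eq_mk_iff']
  exact exists_congr fun _ => eq_comm

/-- The stabilizer of a point of a projective line is diagonalizable. -/
lemma exists_diagonal_stabilizer [CharZero k] [Finite H] (hW : Module.finrank k W = 2)
    {e : W} (he : e ≠ 0) :
    ∃ (e' : W) (a a' : MulAction.stabilizer H (Projectivization.mk k e he) →* kˣ),
      LinearIndependent k ![e, e'] ∧ (∀ g, g • e = a g • e) ∧ ∀ g, g • e' = a' g • e' := by
  obtain ⟨a, ha⟩ := exists_character (H := MulAction.stabilizer H (Projectivization.mk k e he))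
    (k := k) he fun g => (smul_mk_eq_iff g.1 he).mp g.2
  obtain ⟨e', a', h, ha'⟩ := exists_complementary_eigenvector hW he a ha
  exact ⟨e', a, a', h, ha, ha'⟩

lemma exists_smul_add_smul_eq (hW : Module.finrank k W = 2) {e e' : W}
    (h : LinearIndependent k ![e, e']) (w : W) : ∃ s t : k, s • e + t • e' = w := by
  have hspan := h.span_eq_top_of_card_eq_finrank (by simp [hW])
  rw [Matrix.range_cons, Matrix.range_cons, Matrix.range_empty, Set.union_empty,
    Set.singleton_union] at hspan
  exact Submodule.mem_span_pair.mp (hspan ▸ Submodule.mem_top)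

/-- A nontrivial projectivity of finite order of the projective line has exactly two fixed
points. -/
lemma ncard_fixedBy_eq_two [IsAlgClosed k] [CharZero k] [Finite H] (hW : Module.finrank k W = 2)
    {g : H} (hg : g ∉ (MulAction.toPermHom H (ℙ k W)).ker) :
    (MulAction.fixedBy (ℙ k W) g).ncard = 2 := by
  have : FiniteDimensional k W := Module.finite_of_finrank_eq_succ hW
  have : Nontrivial W := Module.nontrivial_of_finrank_pos (R := k) (by omega)
  obtain ⟨c, hc⟩ := Module.End.exists_eigenvalue (DistribSMul.toLinearMap k W g)
  obtain ⟨e, he⟩ := hc.exists_hasEigenvector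
  have hge : g • e = c • e := he.apply_eq_smul
  obtain ⟨e', a, a', hind, ha, ha'⟩ := exists_diagonal_stabilizer (H := H) hW he.2
  obtain ⟨c', hge'⟩ : ∃ c' : k, g • e' = c' • e' :=
    ⟨a' ⟨g, (smul_mk_eq_iff g he.2).mpr ⟨c, hge⟩⟩, ha' ⟨g, _⟩⟩
  have he' : e' ≠ 0 := hind.ne_zero 1
  -- With equal eigenvalues `g` would be scalar and act trivially on the projective line.
  have hcc : c ≠ c' := by
    rintro rfl
    refine hg (Equiv.ext fun p => ?_)
    induction p using Projectivization.ind with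
    | h w hw =>
      refine (smul_mk_eq_iff g hw).mpr ⟨c, ?_⟩
      obtain ⟨s, t, rfl⟩ := exists_smul_add_smul_eq hW hind w
      rw [smul_add, smul_add, smul_comm g s, smul_comm g t, hge, hge', smul_comm s, smul_comm t]
  have hset : MulAction.fixedBy (ℙ k W) g =
      {Projectivization.mk k e he.2, Projectivization.mk k e' he'} := by
    ext p
    induction p using Projectivization.ind with
    | h w hw =>
      rw [MulAction.mem_fixedBy, smul_mk_eq_iff, Set.mem_insert_iff, Set.mem_singleton_iff,
        Projectivization.mk_eq_mk_iff', Projectivization.mk_eq_mk_iff']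
      constructor
      · rintro ⟨d, hd⟩
        obtain ⟨s, t, rfl⟩ := exists_smul_add_smul_eq hW hind w
        have h0 : (s * (c - d)) • e + (t * (c' - d)) • e' = 0 := by
          rw [smul_add, smul_comm g s, smul_comm g t, hge, hge'] at hd
          rw [← sub_eq_zero] at hd
          rw [← hd]
          module
        obtain ⟨h1, h2⟩ := LinearIndependent.pair_iff.mp hind _ _ h0
        rcases mul_eq_zero.mp h1 with rfl | h1
        · exact Or.inr ⟨t, by simp⟩
        · rcases mul_eq_zero.mp h2 with rfl | h2
          · exact Or.inl ⟨s, by simp⟩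
          · exact absurd ((sub_eq_zero.mp h1).trans (sub_eq_zero.mp h2).symm) hcc
      · rintro (⟨s, rfl⟩ | ⟨s, rfl⟩)
        · exact ⟨c, by rw [smul_comm g s, hge, smul_comm]⟩
        · exact ⟨c', by rw [smul_comm g s, hge', smul_comm]⟩
  rw [hset, Set.ncard_pair]
  rw [Ne, Projectivization.mk_eq_mk_iff']
  rintro ⟨s, hs⟩
  have := (LinearIndependent.pair_iff.mp hind 1 (-s) (by rw [hs.symm]; simp)).1
  exact one_ne_zero this

/-- An orbit on the projective line whose stabilizers have order at least `6` modulo scalars has at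
most two elements. -/
lemma card_orbit_projectiveLine_le_two [IsAlgClosed k] [CharZero k] [Finite H]
    (hW : Module.finrank k W = 2) (p : ℙ k W)
    (hp : 6 * Nat.card (MulAction.toPermHom H (ℙ k W)).ker ≤
      Nat.card (MulAction.stabilizer H p)) : Nat.card (MulAction.orbit H p) ≤ 2 :=
  card_orbit_le_two_of_ker (fun _ hg => ncard_fixedBy_eq_two hW hg) p hp

end Representations

/-! ### Groups fixing a vector and a complementary linear form -/

section FixedPointAndLine

/-- The action of a group on a stable subspace. -/
abbrev stableSubspaceAction {k : Type*} [Field k] {H : Type*} [Group H] {V : Type*}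
    [AddCommGroup V] [Module k V] [DistribMulAction H V] (W : Submodule k V)
    (hW : ∀ (g : H), ∀ w ∈ W, g • w ∈ W) : DistribMulAction H W where
  smul g w := ⟨g • w.1, hW g w w.2⟩
  one_smul w := Subtype.ext (one_smul H w.1)
  mul_smul g g' w := Subtype.ext (mul_smul g g' w.1)
  smul_zero g := Subtype.ext (smul_zero g)
  smul_add g w w' := Subtype.ext (smul_add g w.1 w'.1)

variable {k : Type*} [Field k]

/-- A group of homologies with center `v` and axis `l = 0` leaving semi-invariant a nonsingular form
of degree `n` has order at most `n`. -/
lemma card_homologies_le [CharZero k]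
    {H : Type*} [Group H] [DistribMulAction H (Fin 3 → k)] [SMulCommClass H k (Fin 3 → k)]
    {f : MvPolynomial (Fin 3) k} {n : ℕ} (hn : 2 ≤ n) (hdeg : f.IsHomogeneous n)
    (hf : ¬ IsSingular f)
    (hinv : ∀ g : H, ∃ c : k, ∀ x : Fin 3 → k, MvPolynomial.eval (g • x) f =
      c * MvPolynomial.eval x f)
    {v : Fin 3 → k} (hv : ∀ g : H, g • v = v) {l : (Fin 3 → k) →ₗ[k] k} (hlv : l v = 1)
    (a : H →* kˣ) (ha : ∀ (g : H) (w : Fin 3 → k), l w = 0 → g • w = a g • w)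
    (ha1 : ∀ g, a g = 1 → g = 1)
    {w₁ : Fin 3 → k} (hw₁ : l w₁ = 0) (hfw₁ : MvPolynomial.eval w₁ f ≠ 0) :
    Nat.card H ≤ n := by
  have := CharZero.infinite k
  have hv0 : v ≠ 0 := by rintro rfl; simp at hlv
  choose c hc using hinv
  have hpow : ∀ g, c g = (a g : k) ^ n := fun g => by
    have h := hc g w₁
    rw [ha g w₁ hw₁, Units.smul_def, eval_smul_of_isHomogeneous hdeg] at h
    exact (mul_right_cancel₀ hfw₁ h).symm
  have hder : ∀ g u, derivAt v f (g • u) = c g * derivAt v f u := fun g u => by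
    have h := derivAt_map (DistribSMul.toLinearMap k (Fin 3 → k) g) (hc g) v u
    simpa only [DistribSMul.toLinearMap_apply, hv] using h
  -- On the axis `c g = (a g)^n`. If the derivative at `v` is nonzero along `v`, then `c g = 1`;
  -- otherwise it is nonzero along a vector of the axis, so `c g = a g` and `(a g)^(n-1) = 1`.
  by_cases hvv : derivAt v f v = 0
  · obtain ⟨w, hw, hvw⟩ : ∃ w, l w = 0 ∧ derivAt v f w ≠ 0 := by
      by_contra! h
      refine derivAt_ne_zero (by omega) hdeg hf hv0 (LinearMap.ext fun x => ?_)
      have h := h (x - l x • v) (by simp [hlv])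
      simpa [hvv] using h
    refine (card_le_of_pow_eq_one a (K := n - 1) (by omega) (fun g => ?_) ha1).trans (by omega)
    have h := hder g w
    rw [ha g w hw, Units.smul_def, map_smul, smul_eq_mul] at h
    have h := (mul_right_cancel₀ hvw h).trans (hpow g)
    obtain ⟨m, rfl⟩ : ∃ m, n = m + 1 := ⟨n - 1, by omega⟩
    refine Units.ext (mul_left_cancel₀ (a g).ne_zero ?_)
    rw [Nat.add_sub_cancel, Units.val_pow_eq_pow_val, ← pow_succ', ← h]
    simp
  · refine card_le_of_pow_eq_one a (by omega) (fun g => ?_) ha1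
    have h := hder g v
    rw [hv, eq_comm, mul_eq_right₀ hvv, hpow] at h
    exact Units.ext (by simpa using h)

/-- A nonsingular form does not vanish identically on a line. -/
lemma exists_eval_ne_zero_of_line [IsAlgClosed k] [CharZero k]
    {f : MvPolynomial (Fin 3) k} {n : ℕ} (hn : 2 ≤ n) (hdeg : f.IsHomogeneous n)
    (hf : ¬ IsSingular f) {l : (Fin 3 → k) →ₗ[k] k} {v : Fin 3 → k} (hlv : l v = 1)
    {e e' : Fin 3 → k} (he : l e = 0) (he' : l e' = 0) (hind : LinearIndependent k ![e, e']) :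
    ∃ w, l w = 0 ∧ MvPolynomial.eval w f ≠ 0 := by
  have := CharZero.infinite k
  by_contra! h
  -- If `f` vanished on the line, its derivatives along the line would vanish there too. The
  -- transversal derivative is a form of degree `n - 1 > 0`, so it has a zero on the line, which
  -- would be a singular point.
  obtain ⟨s, t, hst, h0⟩ := exists_eval_eq_zero_of_plane (isHomogeneous_dirDeriv hdeg v)
    (by omega) (x := e) (u := e')
  set w := s • e + t • e'
  have hlw : l w = 0 := by simp [w, he, he']
  have hw : w ≠ 0 := fun hw => by
    have := LinearIndependent.pair_iff.mp hind s t hw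
    tauto
  refine derivAt_ne_zero (by omega) hdeg hf hw (LinearMap.ext fun x => ?_)
  have hx : derivAt w f (x - l x • v) = 0 := by
    refine derivAt_eq_zero_of_restrictLine_eq_zero (Polynomial.funext fun t => ?_)
    rw [eval_restrictLine, Polynomial.eval_zero]
    exact h _ (by simp [hlw, hlv])
  have hv : derivAt w f v = 0 := h0
  simpa [hv] using hx

/-- An orbit of zeros of a form of degree `n` on a line on which the form is not identically zero
has at most `n` elements. -/
lemma card_orbit_le_of_zeros [Infinite k] {σ : Type*} [Fintype σ] {f : MvPolynomial σ k} {n : ℕ}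
    (hdeg : f.IsHomogeneous n) {W : Submodule k (σ → k)} (hW : Module.finrank k W = 2)
    {w₀ w₁ : W} (hw₀ : w₀ ≠ 0) (hfw₀ : MvPolynomial.eval w₀.1 f = 0)
    (hfw₁ : MvPolynomial.eval w₁.1 f ≠ 0) (S : Set (ℙ k W))
    (hS : ∀ (w : W) (hw : w ≠ 0), Projectivization.mk k w hw ∈ S → MvPolynomial.eval w.1 f = 0) :
    Nat.card S ≤ n := by
  classical
  have hzero : ∀ (c : k) (w : W), MvPolynomial.eval w.1 f = 0 →
      MvPolynomial.eval (c • w.1) f = 0 := fun c w h => by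
    rw [eval_smul_of_isHomogeneous hdeg, h, mul_zero]
  have hind : LinearIndependent k ![w₀, w₁] := by
    rw [LinearIndependent.pair_iff' hw₀]
    intro c hc
    exact hfw₁ (by rw [← hc]; exact hzero c w₀ hfw₀)
  set q := restrictLine w₀.1 w₁.1 f with hq
  have hq0 : q ≠ 0 := fun h => by
    have h := eval_eq_of_eval_add_smul hdeg (x := w₀.1) (u := w₁.1) (c := 0)
      (fun t => by rw [← eval_restrictLine, ← hq, h, Polynomial.eval_zero]) 0
    exact hfw₁ (by simpa using h)
  have hne : ∀ t : k, w₀ + t • w₁ ≠ 0 := fun t h => by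
    have := (LinearIndependent.pair_iff.mp hind 1 t (by rwa [one_smul])).1
    exact one_ne_zero this
  -- The only point missed by this chart is that of `w₁`, where `f` does not vanish.
  let φ : k → ℙ k W := fun t => Projectivization.mk k (w₀ + t • w₁) (hne t)
  have hsub : S ⊆ (q.roots.toFinset.image φ : Finset (ℙ k W)) := by
    intro p hp
    induction p using Projectivization.ind with
    | h w hw =>
      have hfw := hS w hw hp
      obtain ⟨s, t, rfl⟩ := exists_smul_add_smul_eq hW hind w
      have hs : s ≠ 0 := by
        rintro rfl
        have ht : t ≠ 0 := by
          rintro rfl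
          simp at hw
        refine hfw₁ ?_
        have := hzero t⁻¹ _ hfw
        simpa [smul_smul, ht] using this
      refine Finset.mem_coe.mpr (Finset.mem_image.mpr ⟨t / s, ?_, ?_⟩)
      · rw [Multiset.mem_toFinset, Polynomial.mem_roots hq0, Polynomial.IsRoot, hq,
          eval_restrictLine]
        have := hzero s⁻¹ _ hfw
        simpa [smul_add, smul_smul, hs, div_eq_inv_mul] using this
      · rw [Projectivization.mk_eq_mk_iff']
        exact ⟨s⁻¹, by simp [smul_add, smul_smul, hs, div_eq_inv_mul]⟩
  calc Nat.card S = S.ncard := Nat.card_coe_set_eq S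
    _ ≤ (q.roots.toFinset.image φ).card := by
        rw [← Set.ncard_coe_finset]
        exact Set.ncard_le_ncard hsub (Finset.finite_toSet _)
    _ ≤ q.roots.toFinset.card := Finset.card_image_le
    _ ≤ q.roots.card := Multiset.toFinset_card_le _
    _ ≤ q.natDegree := Polynomial.card_roots' q
    _ ≤ n := natDegree_restrictLine_le _ _ hdeg

/-- A finite group acting faithfully on `k³`, fixing a vector and a linear form which does not
vanish on it, and leaving semi-invariant a nonsingular form of degree `n`, has order less than
`6 * n ^ 2`. -/
theorem card_lt_of_fixed_vector_and_form [IsAlgClosed k] [CharZero k]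
    {H : Type*} [Group H] [Finite H] [DistribMulAction H (Fin 3 → k)]
    [SMulCommClass H k (Fin 3 → k)]
    {f : MvPolynomial (Fin 3) k} {n : ℕ} (hn : 3 ≤ n) (hdeg : f.IsHomogeneous n)
    (hf : ¬ IsSingular f)
    (hinv : ∀ g : H, ∃ c : k, ∀ x : Fin 3 → k, MvPolynomial.eval (g • x) f =
      c * MvPolynomial.eval x f)
    (hfaith : ∀ g : H, (∀ x : Fin 3 → k, g • x = x) → g = 1)
    {v : Fin 3 → k} (hv : ∀ g : H, g • v = v) {l : (Fin 3 → k) →ₗ[k] k} (hlv : l v = 1)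
    (hl : ∀ (g : H) x, l (g • x) = l x) : Nat.card H < 6 * n ^ 2 := by
  have := CharZero.infinite k
  by_contra! hcard
  set W := l.ker
  have hmem : ∀ {w}, w ∈ W ↔ l w = 0 := LinearMap.mem_ker
  have hstable : ∀ (g : H), ∀ w ∈ W, g • w ∈ W := fun g w hw => by
    rw [hmem] at hw ⊢
    rw [hl, hw]
  let _ : DistribMulAction H W := stableSubspaceAction W hstable
  have : SMulCommClass H k W := ⟨fun g c w => Subtype.ext (smul_comm g c w.1)⟩
  have hW : Module.finrank k W = 2 := by
    have hsurj : Function.Surjective l := fun c => ⟨c • v, by simp [hlv]⟩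
    have := l.finrank_range_add_finrank_ker
    rw [LinearMap.range_eq_top.mpr hsurj, finrank_top, Module.finrank_self,
      Module.finrank_fin_fun] at this
    change 1 + Module.finrank k W = 3 at this
    omega
  let b := Module.finBasisOfFinrankEq k W hW
  have hb : ∀ i, l (b i) = 0 := fun i => hmem.mp (b i).2
  have hbind : LinearIndependent k ![((b 0 : W) : Fin 3 → k), b 1] := by
    refine LinearIndependent.pair_iff.mpr fun s t hst => ?_
    have h := Fintype.linearIndependent_iff.mp b.linearIndependent ![s, t]
      (by rw [Fin.sum_univ_two]; exact Subtype.ext hst)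
    exact ⟨h 0, h 1⟩
  have hdecomp : ∀ x, ∃ w : W, x = w + l x • v := fun x =>
    ⟨⟨x - l x • v, hmem.mpr (by simp [hlv])⟩, by simp⟩
  -- a point of the line on the curve and one off the curve
  obtain ⟨w₁, hlw₁, hfw₁⟩ := exists_eval_ne_zero_of_line (by omega) hdeg hf hlv (hb 0) (hb 1) hbind
  obtain ⟨s, t, hst, hfw₀⟩ := exists_eval_eq_zero_of_plane hdeg (by omega)
    (x := ((b 0 : W) : Fin 3 → k)) (u := b 1)
  obtain ⟨w₀, hw₀, hfw₀⟩ : ∃ w₀ : W, w₀ ≠ 0 ∧ MvPolynomial.eval w₀.1 f = 0 := by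
    refine ⟨s • b 0 + t • b 1, fun h => ?_, hfw₀⟩
    have := LinearIndependent.pair_iff.mp hbind s t (congrArg Subtype.val h)
    tauto
  set p := Projectivization.mk k w₀ hw₀ with hp
  -- the homologies
  have hker : Nat.card (MulAction.toPermHom H (ℙ k W)).ker ≤ n := by
    -- A linear map for which every nonzero vector is an eigenvector is a scalar.
    have hscal : ∀ z : (MulAction.toPermHom H (ℙ k W)).ker, ∃ c : k, ∀ w : W, z • w = c • w := by
      intro z
      obtain ⟨c, hc⟩ :=
        (DistribSMul.toLinearMap k W z).exists_eq_smul_id_of_forall_notLinearIndependent fun w hw => by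
          have hw0 : w ≠ 0 := hw.ne_zero 0
          obtain ⟨c, hc⟩ := (smul_mk_eq_iff (k := k) z.1 hw0).mp
            (congrArg (fun σ : Equiv.Perm (ℙ k W) => σ (Projectivization.mk k w hw0)) z.2)
          exact (LinearIndependent.pair_iff' hw0).mp hw c hc.symm
      exact ⟨c, fun w => LinearMap.congr_fun hc w⟩
    obtain ⟨a, ha⟩ := exists_character (H := (MulAction.toPermHom H (ℙ k W)).ker) (k := k) hw₀
      fun z => (hscal z).imp fun c hc => hc w₀
    have haW : ∀ (z : (MulAction.toPermHom H (ℙ k W)).ker) (w : W), z • w = a z • w := by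
      intro z w
      obtain ⟨c, hc⟩ := hscal z
      have : c = a z := smul_left_injective k hw₀ ((hc w₀).symm.trans (ha z))
      rw [hc, this, Units.smul_def]
    have haV : ∀ (z : (MulAction.toPermHom H (ℙ k W)).ker) (w : Fin 3 → k), l w = 0 →
        z • w = a z • w := fun z w hw =>
      congrArg Subtype.val (haW z ⟨w, hmem.mpr hw⟩)
    refine card_homologies_le (by omega) hdeg hf (fun z => hinv z.1) (fun z => hv z.1) hlv a haV
      (fun z hz => Subtype.ext (hfaith z.1 fun x => ?_)) hlw₁ hfw₁
    obtain ⟨w, hw⟩ := hdecomp x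
    rw [hw, smul_add, smul_comm z.1, hv]
    congr 1
    have h := haV z w (hmem.mp w.2)
    rwa [hz, one_smul] at h
  -- the orbit of the point on the curve
  have horb : Nat.card (MulAction.orbit H p) ≤ n := by
    refine card_orbit_le_of_zeros (w₁ := ⟨w₁, hmem.mpr hlw₁⟩) hdeg hW hw₀ hfw₀ hfw₁ _ ?_
    rintro w hw ⟨g, hg⟩
    have hg : g • p = Projectivization.mk k w hw := hg
    rw [hp, Projectivization.smul_mk, Projectivization.mk_eq_mk_iff'] at hg
    obtain ⟨d, hd⟩ := hg
    obtain ⟨c, hc⟩ := hinv g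
    have h : MvPolynomial.eval (d • w.1) f = 0 := by
      have : d • w.1 = g • w₀.1 := congrArg Subtype.val hd
      rw [this, hc, hfw₀, mul_zero]
    rw [eval_smul_of_isHomogeneous hdeg] at h
    refine (mul_eq_zero.mp h).resolve_left fun h => ?_
    rw [pow_eq_zero_iff (by omega)] at h
    rw [h, zero_smul, eq_comm, smul_eq_zero_iff_eq] at hd
    exact hw₀ hd
  have hos := card_orbit_mul_card_stabilizer (H := H) p
  have hstab : 6 * n ≤ Nat.card (MulAction.stabilizer H p) := by
    by_contra! h
    nlinarith [Nat.mul_le_mul horb h.le]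
  -- The required `6 * |ker|` is at most `6 * n`, hence at most the order of the stabilizer.
  have htwo := card_orbit_projectiveLine_le_two (H := H) hW p (by omega)
  -- the stabilizer is diagonal
  obtain ⟨e', a, a', hind, ha, ha'⟩ := exists_diagonal_stabilizer (H := H) hW hw₀
  have hbasis : LinearIndependent k ![(w₀ : Fin 3 → k), e', v] := by
    rw [LinearIndependent.pair_iff] at hind
    rw [Fintype.linearIndependent_iff]
    intro c hc
    simp only [Fin.sum_univ_three, Matrix.cons_val] at hc
    have h2 : c 2 = 0 := by simpa [hlv, hmem.mp w₀.2, hmem.mp e'.2] using congrArg l hc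
    rw [h2, zero_smul, add_zero] at hc
    have h01 := hind (c 0) (c 1) (Subtype.ext hc)
    intro i
    fin_cases i
    exacts [h01.1, h01.2, h2]
  have hle : Nat.card (MulAction.stabilizer H p) ≤ n ^ 2 := by
    refine card_le_sq_of_diagonal hn hdeg hf (fun g => hinv g.1) hbasis ![a, a', 1] ?_ ?_
    · intro i g
      fin_cases i
      · exact congrArg Subtype.val (ha g)
      · exact congrArg Subtype.val (ha' g)
      · exact (hv g.1).trans (one_smul kˣ v).symm
    · intro g hg
      have h0 : a g = 1 := hg 0 2
      have h1 : a' g = 1 := hg 1 2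
      refine Subtype.ext (hfaith g.1 fun x => ?_)
      obtain ⟨w, hw⟩ := hdecomp x
      rw [hw, smul_add, smul_comm g.1, hv]
      congr 1
      obtain ⟨s, t, rfl⟩ := exists_smul_add_smul_eq hW hind w
      have h : g • (s • w₀ + t • e') = s • w₀ + t • e' := by
        rw [smul_add, smul_comm g s, smul_comm g t, ha, ha', h0, h1, one_smul, one_smul]
      exact congrArg Subtype.val h
  have : 0 < n ^ 2 := by positivity
  nlinarith [Nat.mul_le_mul htwo hle]

end FixedPointAndLine

/-! ### Lifting subgroups of the projective group to matrices -/

section Lifting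

variable {k : Type*} [Field k]

lemma generalLinearGroup_smul_eq (A : GL (Fin 3) k) (x : Fin 3 → k) : A • x = A.1.mulVec x := rfl

lemma scalar_smul_eq (u : kˣ) (x : Fin 3 → k) :
    Matrix.GeneralLinearGroup.scalar (Fin 3) u • x = u • x := by
  rw [generalLinearGroup_smul_eq]
  simp [Units.smul_def]

lemma eq_one_of_forall_smul_eq {A : GL (Fin 3) k} (h : ∀ x : Fin 3 → k, A • x = x) : A = 1 := by
  refine Units.ext (Matrix.toLin'.injective (LinearMap.ext fun x => ?_))
  simpa using! h x

/-- A semi-invariant form for a group of projectivities is semi-invariant for all its lifts. -/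
lemma IsInvariant.exists_eval_smul {G : Subgroup (PGL(3, k))} {f : MvPolynomial (Fin 3) k}
    (hinv : IsInvariant G f) {A : GL (Fin 3) k} (hA : Matrix.ProjGenLinGroup.mk A ∈ G) :
    ∃ c : k, ∀ x : Fin 3 → k, MvPolynomial.eval (A • x) f = c * MvPolynomial.eval x f := by
  -- `transform` substitutes the inverse matrix, so `A⁻¹` gives the substitution by `A`.
  obtain ⟨c, -, hc⟩ := hinv A⁻¹ (by rw [map_inv]; exact inv_mem hA)
  refine ⟨c, fun x => ?_⟩
  have h := congrArg (MvPolynomial.eval x) hc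
  rw [map_mul, MvPolynomial.eval_C] at h
  rw [← h, transform, inv_inv, ← MvPolynomial.coe_aeval_eq_eval, ← MvPolynomial.coe_aeval_eq_eval,
    RingHom.coe_coe, RingHom.coe_coe, MvPolynomial.aeval_bind₁]
  congr 1
  congr 1
  ext i
  simp [generalLinearGroup_smul_eq, Matrix.mulVec, dotProduct]

/-- The lift of a group of projectivities to a group of matrices which contains no scalars. -/
def lift (G : Subgroup (PGL(3, k))) (L : Subgroup (GL (Fin 3) k)) : Subgroup (GL (Fin 3) k) :=
  L ⊓ G.comap Matrix.ProjGenLinGroup.mk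

/-- The hypotheses make `L` contain exactly one representative of every class in `G`: two of them
would differ by a scalar in `L`. -/
lemma lift_bijective {G : Subgroup (PGL(3, k))} {L : Subgroup (GL (Fin 3) k)}
    (hinj : ∀ u : kˣ, Matrix.GeneralLinearGroup.scalar (Fin 3) u ∈ L → u = 1)
    (hsurj : ∀ A, Matrix.ProjGenLinGroup.mk A ∈ G →
      ∃ u : kˣ, A * Matrix.GeneralLinearGroup.scalar (Fin 3) u ∈ L) :
    Function.Bijective (fun A : lift G L => (⟨Matrix.ProjGenLinGroup.mk A.1, A.2.2⟩ : G)) := by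
  constructor
  · intro A B hAB
    have hAB : Matrix.ProjGenLinGroup.mk A.1 = Matrix.ProjGenLinGroup.mk B.1 :=
      congrArg Subtype.val hAB
    obtain ⟨u, hu⟩ := Matrix.ProjGenLinGroup.mk_eq_mk_iff.mp hAB
    have hmem : Matrix.GeneralLinearGroup.scalar (Fin 3) u ∈ L := by
      rw [← inv_mul_eq_iff_eq_mul.mpr hu.symm]
      exact L.mul_mem (L.inv_mem A.2.1) B.2.1
    rw [hinj u hmem, map_one, mul_one] at hu
    exact Subtype.ext hu
  · rintro ⟨g, hg⟩
    obtain ⟨A, rfl⟩ := Matrix.ProjGenLinGroup.mk_surjective g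
    obtain ⟨u, hu⟩ := hsurj A hg
    have hmk : Matrix.ProjGenLinGroup.mk (A * Matrix.GeneralLinearGroup.scalar (Fin 3) u) =
        Matrix.ProjGenLinGroup.mk A := by
      rw [map_mul, Matrix.ProjGenLinGroup.mk_scalar, mul_one]
    exact ⟨⟨_, hu, Subgroup.mem_comap.mpr (by rwa [hmk])⟩, Subtype.ext hmk⟩

/-- Each representative has `v` as an eigenvector; dividing by the eigenvalue is the only rescaling
that fixes `v` itself. -/
lemma lift_stabilizer_bijective {G : Subgroup (PGL(3, k))} {v : Fin 3 → k} (hv : v ≠ 0)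
    (hG : ∀ g ∈ G, g • Projectivization.mk k v hv = Projectivization.mk k v hv) :
    Function.Bijective (fun A : lift G (MulAction.stabilizer (GL (Fin 3) k) v) =>
      (⟨Matrix.ProjGenLinGroup.mk A.1, A.2.2⟩ : G)) := by
  refine lift_bijective (fun u hu => ?_) fun A hA => ?_
  · rw [MulAction.mem_stabilizer_iff, scalar_smul_eq] at hu
    exact Units.ext (smul_left_injective k hv (by simpa [Units.smul_def] using hu))
  · have h := hG _ hA
    rw [Projectivization.PGL.mk_smul_mk, Projectivization.mk_eq_mk_iff] at h
    obtain ⟨u, hu⟩ := h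
    refine ⟨u⁻¹, ?_⟩
    rw [MulAction.mem_stabilizer_iff, mul_smul, scalar_smul_eq, smul_comm, ← hu, inv_smul_smul]

/-- The group of matrices preserving the last coordinate of all vectors. -/
def lastCoordStabilizer (k : Type*) [Field k] : Subgroup (GL (Fin 3) k) where
  carrier := {A | ∀ x : Fin 3 → k, (A • x) 2 = x 2}
  one_mem' := fun x => by rw [one_smul]
  mul_mem' := fun {A B} hA hB x => by rw [mul_smul, hA, hB]
  inv_mem' := fun {A} hA x => by rw [← hA (A⁻¹ • x), smul_inv_smul]

/-- A matrix preserving the line multiplies the last coordinate by a constant, nonzero by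
invertibility; dividing by it selects a unique representative. -/
lemma lift_lastCoordStabilizer_bijective {G : Subgroup (PGL(3, k))} (hG : FixesLineZ G) :
    Function.Bijective (fun A : lift G (lastCoordStabilizer k) =>
      (⟨Matrix.ProjGenLinGroup.mk A.1, A.2.2⟩ : G)) := by
  have hmem : ∀ (w : Fin 3 → k) (hw : w ≠ 0), Projectivization.mk k w hw ∈ lineZ k ↔ w 2 = 0 := by
    intro w hw
    obtain ⟨u, hu⟩ := Projectivization.exists_smul_eq_mk_rep k w hw
    change (Projectivization.mk k w hw).rep 2 = 0 ↔ _
    rw [← hu]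
    simp [Units.smul_def]
  refine lift_bijective (fun u hu => ?_) fun A hA => ?_
  · have h := hu ![0, 0, 1]
    rw [scalar_smul_eq] at h
    exact Units.ext (by simpa [Units.smul_def] using h)
  · have hline : ∀ w : Fin 3 → k, w 2 = 0 → (A • w) 2 = 0 := by
      intro w hw2
      by_cases hw : w = 0
      · simp [hw]
      · have h : Matrix.ProjGenLinGroup.mk A • Projectivization.mk k w hw ∈ lineZ k := by
          rw [← hG _ hA]
          exact Set.mem_image_of_mem _ ((hmem w hw).mpr hw2)
        rw [Projectivization.PGL.mk_smul_mk] at h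
        exact (hmem _ _).mp h
    have hcoord : ∀ x : Fin 3 → k, (A • x) 2 = x 2 * (A • (![0, 0, 1] : Fin 3 → k)) 2 := by
      intro x
      have h := hline (x - x 2 • ![0, 0, 1]) (by simp)
      rw [smul_sub, smul_comm] at h
      simpa [sub_eq_zero] using h
    have hne : (A • (![0, 0, 1] : Fin 3 → k)) 2 ≠ 0 := by
      intro h0
      have h := hcoord (A⁻¹ • ![0, 0, 1])
      rw [smul_inv_smul, h0, mul_zero] at h
      exact one_ne_zero h
    refine ⟨(Units.mk0 _ hne)⁻¹, fun x => ?_⟩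
    rw [mul_smul, scalar_smul_eq, hcoord]
    rw [Pi.smul_apply, Units.smul_def, Units.val_inv_eq_inv_val, Units.val_mk0, smul_eq_mul,
      mul_right_comm, inv_mul_cancel₀ hne, one_mul]

/-- A finite group of matrices preserving the last coordinate fixes a vector off the plane on which
this coordinate vanishes. -/
lemma exists_fixed_vector [CharZero k] (H : Subgroup (GL (Fin 3) k)) [Finite H]
    (hH : H ≤ lastCoordStabilizer k) :
    ∃ v : Fin 3 → k, v 2 = 1 ∧ ∀ g : H, g • v = v := by
  have := Fintype.ofFinite H
  have hcard : (Fintype.card H : k) ≠ 0 := Nat.cast_ne_zero.mpr Fintype.card_ne_zero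
  refine ⟨(Fintype.card H : k)⁻¹ • ∑ h : H, h • ![0, 0, 1], ?_, fun g => ?_⟩
  · have h1 : ∀ h : H, (h • (![0, 0, 1] : Fin 3 → k)) 2 = 1 := fun h => hH h.2 ![0, 0, 1]
    simp [h1, hcard]
  · rw [smul_comm, Finset.smul_sum,
      ← Equiv.sum_comp (Equiv.mulLeft g) fun h => h • (![0, 0, 1] : Fin 3 → k)]
    simp only [Equiv.coe_mulLeft, mul_smul]

end Lifting

/-! ### The bounds on the group order in the three cases -/

section Cases

variable {k : Type*} [Field k] [CharZero k] {G : Subgroup (PGL(3, k))}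
  {n : ℕ} {f : MvPolynomial (Fin 3) k}

/-- A group of projectivities fixing the vertices of a triangle has order at most `n ^ 2` if a
nonsingular form of degree `n` is semi-invariant. -/
lemma card_le_sq_of_fixes_triangle (hn : 3 ≤ n) (hdeg : f.IsHomogeneous n)
    (hinv : IsInvariant G f) (hf : ¬ IsSingular f) {P : Fin 3 → ℙ k (Fin 3 → k)}
    (hP : Projectivization.Independent P) (hG : ∀ g ∈ G, ∀ i, g • P i = P i) :
    Nat.card G ≤ n ^ 2 := by
  have hb := Projectivization.independent_iff.mp hP
  have hmk : ∀ i, Projectivization.mk k (P i).rep (P i).rep_nonzero = P i := fun i => (P i).mk_rep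
  -- Normalizing the lift to fix a vector over `P 2` gives `a 2 = 1`, so equal characters at some
  -- element mean that it is the identity.
  have hbij := lift_stabilizer_bijective (P 2).rep_nonzero
    (fun g hg => by rw [hmk]; exact hG g hg 2)
  rw [← Nat.card_eq_of_bijective _ hbij]
  set H := lift G (MulAction.stabilizer (GL (Fin 3) k) (P 2).rep)
  have hchar : ∀ i, ∃ a : H →* kˣ, ∀ g, g • (P i).rep = a g • (P i).rep := fun i =>
    exists_character (P i).rep_nonzero fun g => by
      have h := hG _ g.2.2 i
      rw [← hmk i, Projectivization.PGL.mk_smul_mk, Projectivization.mk_eq_mk_iff'] at h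
      exact h.imp fun c hc => hc.symm
  choose a ha using hchar
  refine card_le_sq_of_diagonal hn hdeg hf (fun g => hinv.exists_eval_smul g.2.2) hb a
    (fun i g => ha i g) fun g hg => Subtype.ext (eq_one_of_forall_smul_eq ?_)
  have h2 : a 2 g = 1 := by
    have h : g • (P 2).rep = (P 2).rep := g.2.1
    rw [ha] at h
    exact Units.ext (smul_left_injective k (P 2).rep_nonzero
      (by simpa [Units.smul_def] using h))
  have hlin : DistribSMul.toLinearMap k (Fin 3 → k) g = LinearMap.id := by
    refine LinearMap.ext_on_range (hb.span_eq_top_of_card_eq_finrank (by simp)) fun i => ?_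
    simp only [DistribSMul.toLinearMap_apply, Function.comp_apply, LinearMap.id_apply]
    rw [ha, hg i 2, h2, one_smul]
  exact fun x => LinearMap.congr_fun hlin x

lemma card_le_of_permutesTriangleCyclically (hn : 3 ≤ n) (hdeg : f.IsHomogeneous n)
    (hinv : IsInvariant G f) (hf : ¬ IsSingular f) (hG : PermutesTriangleCyclically G) :
    Nat.card G ≤ 3 * n ^ 2 := by
  obtain ⟨P, hP, hcyc, -⟩ := hG
  have hPinj : Function.Injective P := fun i j hij =>
    (Projectivization.independent_iff.mp hP).injective (congrArg Projectivization.rep hij)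
  have horb : Nat.card (MulAction.orbit G (P 0)) ≤ 3 := by
    have hsub : MulAction.orbit G (P 0) ⊆ Set.range P := by
      rintro _ ⟨g, rfl⟩
      obtain ⟨j, hj⟩ := hcyc g.1 g.2
      exact ⟨_, (hj 0).symm⟩
    calc Nat.card (MulAction.orbit G (P 0)) ≤ Nat.card (Set.range P) :=
          Nat.card_mono (Set.finite_range P) hsub
      _ ≤ 3 := by simpa using Finite.card_range_le P
  have hle : Nat.card ((MulAction.stabilizer G (P 0)).map G.subtype) ≤ n ^ 2 := by
    refine card_le_sq_of_fixes_triangle hn hdeg (fun A hA => hinv A ?_) hf hP ?_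
    · exact Subgroup.map_subtype_le _ hA
    · rintro _ ⟨g, hg, rfl⟩ i
      obtain ⟨j, hj⟩ := hcyc g.1 g.2
      -- A power of the 3-cycle fixing one vertex is trivial, so the stabilizer of `P 0` fixes the
      -- whole triangle.
      have h0 : 0 + j = 0 := hPinj ((hj 0).symm.trans hg)
      have h := hj i
      rw [zero_add] at h0
      rwa [h0, add_zero] at h
  rw [← Nat.card_congr ((MulAction.stabilizer G (P 0)).equivMapOfInjective _
    G.subtype_injective).toEquiv] at hle
  rw [← card_orbit_mul_card_stabilizer (H := G) (P 0)]
  exact Nat.mul_le_mul horb hle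

variable [IsAlgClosed k] [Finite G]

lemma card_lt_of_fixesPointZ (hn : 3 ≤ n) (hdeg : f.IsHomogeneous n) (hinv : IsInvariant G f)
    (hf : ¬ IsSingular f) (hG : FixesPointZ G) : Nat.card G < 6 * n ^ 2 := by
  have hv : (![0, 0, 1] : Fin 3 → k) ≠ 0 := fun h => one_ne_zero (congrFun h 2)
  have hbij := lift_stabilizer_bijective hv hG
  rw [← Nat.card_eq_of_bijective _ hbij]
  have := Finite.of_injective _ hbij.injective
  -- With the trivial character, averaging supplies an invariant complement to the fixed vector.
  obtain ⟨l, hlv, hl⟩ := exists_semiinvariant_form (k := k) hv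
    (1 : lift G (MulAction.stabilizer (GL (Fin 3) k) (![0, 0, 1] : Fin 3 → k)) →* kˣ)
    (fun g => by rw [MonoidHom.one_apply, one_smul]; exact g.2.1)
  exact card_lt_of_fixed_vector_and_form hn hdeg hf (fun g => hinv.exists_eval_smul g.2.2)
    (fun g hg => Subtype.ext (eq_one_of_forall_smul_eq hg)) (fun g => g.2.1) hlv
    (fun g x => by simpa using hl g x)

lemma card_lt_of_fixesLineZ (hn : 3 ≤ n) (hdeg : f.IsHomogeneous n) (hinv : IsInvariant G f)
    (hf : ¬ IsSingular f) (hG : FixesLineZ G) : Nat.card G < 6 * n ^ 2 := by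
  have hbij := lift_lastCoordStabilizer_bijective hG
  rw [← Nat.card_eq_of_bijective _ hbij]
  have := Finite.of_injective _ hbij.injective
  obtain ⟨v, hlv, hv⟩ := exists_fixed_vector (lift G (lastCoordStabilizer k)) inf_le_left
  exact card_lt_of_fixed_vector_and_form hn hdeg hf (fun g => hinv.exists_eval_smul g.2.2)
    (fun g hg => Subtype.ext (eq_one_of_forall_smul_eq hg)) hv
    (l := LinearMap.proj 2) hlv (fun g x => g.2.1 x)

end Cases

end PlaneCurve


theorem theorem2p3 {k : Type*} [Field k] [IsAlgClosed k] [CharZero k]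
    (G : Subgroup (PGL(3, k))) [Finite G] (n : ℕ) (hn : 11 ≤ n) (hG : 6 * n ^ 2 ≤ Nat.card G)
    (f : MvPolynomial (Fin 3) k) (hf : f ≠ 0) (hdeg : f.IsHomogeneous n)
    (hinv : PlaneCurve.IsInvariant G f)
    (hcase : PlaneCurve.FixesPointZ G ∨ PlaneCurve.FixesLineZ G ∨
      PlaneCurve.PermutesTriangleCyclically G) :
    PlaneCurve.IsSingular f := by
  by_contra hsing
  have hn3 : 3 ≤ n := by omega
  have hpos : 0 < n ^ 2 := by positivity
  rcases hcase with h | h | h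
  · exact absurd (PlaneCurve.card_lt_of_fixesPointZ hn3 hdeg hinv hsing h) (by omega)
  · exact absurd (PlaneCurve.card_lt_of_fixesLineZ hn3 hdeg hinv hsing h) (by omega)
  · exact absurd (PlaneCurve.card_le_of_permutesTriangleCyclically hn3 hdeg hinv hsing h) (by omega)
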